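/- Let $R$ be a firm ring, i.e. an associative ring, not necessarily with unit, such that the multiplication $R\otimes_R R\to R$ is an isomorphism. Let $\mathcal M_R$ be the category of firm right $R$-modules, i.e. those $M$ for which $M\otimes_R R\to M$, $m\otimes r\mapsto mr$, is an isomorphism. Let $A$ be a ring with unit, $\mathfrak C$ an $A$-coring and $\mathcal M^{\mathfrak C}$ the category of right $\mathfrak C$-comodules and right $A$-linear, $\mathfrak C$-colinear maps. Denote the coaction by $\rho(u)=u_{[0]}\otimes_A u_{[1]}$. Let ${}_R\mathcal M^{\mathfrak C}$ be the class of right $\mathfrak C$-comodules $\Sigma$ with a left $R$-module structure that is firm (i.e. $R\otimes_R\Sigma\to\Sigma$ is an isomorphism), commutes with the right $A$-action, and makes the coaction left $R$-linear. For a functor $F:\mathcal M_R\to\mathcal M^{\mathfrak C}$ the following are equivalent: (i) $F$ has a right adjoint; (ii) $F$ is right exact (preserves finite colimits) and preserves all direct sums; (iii) $F\cong-\otimes_R\Sigma$ for some $\Sigma\in{}_R\mathcal M^{\mathfrak C}$. Suppose that these conditions hold. For $r\in R$ let $\lambda_r:R\to R$ be left multiplication by $r$. Then $r\mapsto F(\lambda_r)$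 is a ring morphism $R\to\mathrm{End}^{\mathfrak C}(F(R))$; with the left $R$-action that it defines, $F(R)\in{}_R\mathcal M^{\mathfrak C}$ and $F\cong-\otimes_R F(R)$. Moreover, for every $\Sigma\in{}_R\mathcal M^{\mathfrak C}$ with $F\cong-\otimes_R\Sigma$ (in particular for $\Sigma=F(R)$): (iv) $\mathrm{Hom}^{\mathfrak C}(\Sigma,-)\otimes_R R:\mathcal M^{\mathfrak C}\to\mathcal M_R$ is a right adjoint of $F$, where $R$ acts on $\mathrm{Hom}^{\mathfrak C}(\Sigma,N)$ by $(fr)(u)=f(ru)$, and every right adjoint $G$ of $F$ is isomorphic to it; (v) the left action of $R$ on $\Sigma$ is a ring morphism $\jmath:R\to\mathrm{End}^{\mathfrak C}(\Sigma)$, $\jmath(r)(u)=ru$; (vi) there is a natural transformation of functors from right $A$-modules to right $\mathfrak C$-comodules $$\mathrm{can}_M:\mathrm{Hom}_A(\Sigma,M)\otimes_R\Sigma\to M\otimes_A\mathfrak C,\qquad \mathrm{can}_M(f\otimes_R u)=f(u_{[0]})\otimes_A u_{[1]},$$ where $(fr)(u)=f(ru)$ for $f\in\mathrm{Hom}_A(\Sigma,M)$,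 and the coactions are those induced by $\Sigma$ and by the comultiplication of $\mathfrak C$. -/

import Mathlib

open CategoryTheory CategoryTheory.Limits MulOpposite
open scoped TensorProduct

universe u

namespace FirmCoring

/-! ### Modules over rings that need not have a unit -/

/-- `M` is a left module over the (possibly non-unital) ring `S`.
A right `S`-module is a left module over `Sᵐᵒᵖ`, with `m s` written `op s • m`. -/
class NUModule (S M : Type*) [NonUnitalRing S] [AddCommGroup M] [SMul S M] : Prop where
  smul_add : ∀ (s : S) (m n : M), s • (m + n) = s • m + s • n
  add_smul : ∀ (s t : S) (m : M), (s + t) • m = s • m + t • m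
  mul_smul : ∀ (s t : S) (m : M), (s * t) • m = s • (t • m)

instance (S M : Type*) [Ring S] [AddCommGroup M] [Module S M] : NUModule S M where
  smul_add := _root_.smul_add
  add_smul := _root_.add_smul
  mul_smul := SemigroupAction.mul_smul

instance (R : Type*) [NonUnitalRing R] : NUModule R R where
  smul_add s m n := mul_add s m n
  add_smul s t m := add_mul s t m
  mul_smul s t m := mul_assoc s t m

instance (R : Type*) [NonUnitalRing R] : NUModule Rᵐᵒᵖ R where
  smul_add s m n := add_mul m n s.unop
  add_smul s t m := mul_add m s.unop t.unop
  mul_smul s t m := (mul_assoc m t.unop s.unop).symm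

/-- The action of a scalar as an additive map. -/
def smulHom {S : Type*} (M : Type*) [NonUnitalRing S] [AddCommGroup M] [SMul S M] [NUModule S M]
    (s : S) : M →+ M :=
  AddMonoidHom.mk' (fun m => s • m) (NUModule.smul_add s)

/-! ### The tensor product over a (possibly non-unital, non-commutative) ring -/

section Tens

variable (S : Type*) (M N : Type*) [AddCommGroup M] [AddCommGroup N] [SMul Sᵐᵒᵖ M] [SMul S N]

/-- The relations `m s ⊗ n = m ⊗ s n`. -/
def Tens.rel : Submodule ℤ (M ⊗[ℤ] N) :=
  Submodule.span ℤ
    {t | ∃ (m : M) (s : S) (n : N), t = (op s • m) ⊗ₜ[ℤ] n - m ⊗ₜ[ℤ] (s • n)}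

/-- The tensor product `M ⊗_S N` of a right `S`-module `M` and a left `S`-module `N`, as an
abelian group. -/
def Tens : Type _ := (M ⊗[ℤ] N) ⧸ Tens.rel S M N

instance : AddCommGroup (Tens S M N) := inferInstanceAs (AddCommGroup ((M ⊗[ℤ] N) ⧸ _))

namespace Tens

variable {M N}

/-- The pure tensor `m ⊗_S n`. -/
def tmul (m : M) (n : N) : Tens S M N := Submodule.Quotient.mk (m ⊗ₜ[ℤ] n)

variable {S}

theorem add_tmul (m m' : M) (n : N) : tmul S (m + m') n = tmul S m n + tmul S m' n := by
  unfold tmul; rw [TensorProduct.add_tmul]; rfl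

theorem tmul_add (m : M) (n n' : N) : tmul S m (n + n') = tmul S m n + tmul S m n' := by
  unfold tmul; rw [TensorProduct.tmul_add]; rfl

theorem smul_tmul (s : S) (m : M) (n : N) : tmul S (op s • m) n = tmul S m (s • n) :=
  (Submodule.Quotient.eq _).2 (Submodule.subset_span ⟨m, s, n, rfl⟩)

/-- The additive map out of `M ⊗_S N` induced by a balanced biadditive map. -/
def lift {P : Type*} [AddCommGroup P] (f : M →+ N →+ P)
    (hf : ∀ (s : S) m n, f (op s • m) n = f m (s • n)) : Tens S M N →+ P :=
  ((rel S M N).liftQ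
    (TensorProduct.liftAddHom f (by intro r m n; simp)).toIntLinearMap (by
      rw [rel, Submodule.span_le]
      rintro _ ⟨m, s, n, rfl⟩
      simp [hf])).toAddMonoidHom

@[simp] theorem lift_tmul {P : Type*} [AddCommGroup P] (f : M →+ N →+ P)
    (hf : ∀ (s : S) m n, f (op s • m) n = f m (s • n)) (m : M) (n : N) :
    lift f hf (tmul S m n) = f m n := rfl

theorem hom_ext {P : Type*} [AddCommGroup P] {f g : Tens S M N →+ P}
    (h : ∀ m n, f (tmul S m n) = g (tmul S m n)) : f = g := by
  ext x
  obtain ⟨x, rfl⟩ := Submodule.Quotient.mk_surjective _ x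
  induction x with
  | zero => exact (map_zero f).trans (map_zero g).symm
  | tmul m n => exact h m n
  | add x y hx hy =>
    rw [Submodule.Quotient.mk_add]
    exact (map_add f _ _).trans ((congrArg₂ (· + ·) hx hy).trans (map_add g _ _).symm)

theorem hom_congr {P : Type*} [AddCommGroup P] {f g : Tens S M N →+ P}
    (h : ∀ m n, f (tmul S m n) = g (tmul S m n)) (x : Tens S M N) : f x = g x :=
  DFunLike.congr_fun (hom_ext h) x

variable (S) in
/-- Pure tensors as a biadditive map. -/
def mk : M →+ N →+ Tens S M N :=
  AddMonoidHom.mk' (fun m => AddMonoidHom.mk' (tmul S m) (tmul_add m))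
    (fun m m' => by ext n; exact add_tmul m m' n)

@[simp] theorem mk_apply (m : M) (n : N) : mk S m n = tmul S m n := rfl

/-- The map `f ⊗_S g`. -/
def map {M' N' : Type*} [AddCommGroup M'] [AddCommGroup N'] [SMul Sᵐᵒᵖ M'] [SMul S N']
    (f : M →+ M') (hf : ∀ (s : S) m, f (op s • m) = op s • f m)
    (g : N →+ N') (hg : ∀ (s : S) n, g (s • n) = s • g n) : Tens S M N →+ Tens S M' N' :=
  lift (((mk S).comp f).compr₂ (AddMonoidHom.id _) |>.compl₂ g) (by
    intro s m n
    change tmul S (f (op s • m)) (g n) = tmul S (f m) (g (s • n))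
    rw [hf, hg, smul_tmul])

@[simp] theorem map_tmul {M' N' : Type*} [AddCommGroup M'] [AddCommGroup N'] [SMul Sᵐᵒᵖ M']
    [SMul S N'] (f : M →+ M') (hf : ∀ (s : S) m, f (op s • m) = op s • f m)
    (g : N →+ N') (hg : ∀ (s : S) n, g (s • n) = s • g n) (m : M) (n : N) :
    map f hf g hg (tmul S m n) = tmul S (f m) (g n) := rfl

end Tens

end Tens

namespace Tens

section Actions

variable {S T : Type*} {M N : Type*} [AddCommGroup M] [AddCommGroup N] [SMul Sᵐᵒᵖ M] [SMul S N]
  [NonUnitalRing T]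

/-- If `M` is a `T`-`S`-bimodule, then `M ⊗_S N` is a left `T`-module: `t (m ⊗ n) = t m ⊗ n`. -/
instance [SMul T M] [NUModule T M] [SMulCommClass T Sᵐᵒᵖ M] : SMul T (Tens S M N) where
  smul t := map (smulHom M t) (fun s m => smul_comm t (op s) m) (AddMonoidHom.id N)
    (fun _ _ => rfl)

/-- If `N` is an `S`-`T`-bimodule, then `M ⊗_S N` is a right `T`-module: `(m ⊗ n) t = m ⊗ n t`. -/
instance [SMul Tᵐᵒᵖ N] [NUModule Tᵐᵒᵖ N] [SMulCommClass S Tᵐᵒᵖ N] :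
    SMul Tᵐᵒᵖ (Tens S M N) where
  smul t := map (AddMonoidHom.id M) (fun _ _ => rfl) (smulHom N t)
    (fun s n => (smul_comm s t n).symm)

theorem smul_tmul_left [SMul T M] [NUModule T M] [SMulCommClass T Sᵐᵒᵖ M]
    (t : T) (m : M) (n : N) : t • tmul S m n = tmul S (t • m) n := rfl

theorem op_smul_tmul [SMul Tᵐᵒᵖ N] [NUModule Tᵐᵒᵖ N] [SMulCommClass S Tᵐᵒᵖ N]
    (t : Tᵐᵒᵖ) (m : M) (n : N) : t • tmul S m n = tmul S m (t • n) := rfl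

instance [SMul Tᵐᵒᵖ N] [NUModule Tᵐᵒᵖ N] [SMulCommClass S Tᵐᵒᵖ N] :
    NUModule Tᵐᵒᵖ (Tens S M N) where
  smul_add t x y := map_add (map (AddMonoidHom.id M) (fun _ _ => rfl) (smulHom N t)
    (fun s n => (smul_comm s t n).symm)) x y
  add_smul t t' x := by
    refine hom_congr (f := map (AddMonoidHom.id M) (fun _ _ => rfl) (smulHom N (t + t')) _)
      (g := map (AddMonoidHom.id M) (fun _ _ => rfl) (smulHom N t) _ +
        map (AddMonoidHom.id M) (fun _ _ => rfl) (smulHom N t') _) (fun m n => ?_) x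
    change tmul S m ((t + t') • n) = tmul S m (t • n) + tmul S m (t' • n)
    rw [NUModule.add_smul, tmul_add]
  mul_smul t t' x := by
    refine hom_congr (f := map (AddMonoidHom.id M) (fun _ _ => rfl) (smulHom N (t * t')) _)
      (g := (map (AddMonoidHom.id M) (fun _ _ => rfl) (smulHom N t)
        (fun s n => (smul_comm s t n).symm)).comp
        (map (AddMonoidHom.id M) (fun _ _ => rfl) (smulHom N t')
          (fun s n => (smul_comm s t' n).symm))) (fun m n => ?_) x
    change tmul S m ((t * t') • n) = tmul S m (t • (t' • n))
    rw [NUModule.mul_smul]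

/-- Over a unital ring `A`, the right action on `M ⊗_S N` is unital. -/
instance {A : Type*} [Ring A] [Module Aᵐᵒᵖ N] [SMulCommClass S Aᵐᵒᵖ N] :
    Module Aᵐᵒᵖ (Tens S M N) where
  smul t x := t • x
  smul_add := NUModule.smul_add
  add_smul := NUModule.add_smul
  mul_smul := NUModule.mul_smul
  one_smul x := by
    refine hom_congr (f := map (AddMonoidHom.id M) (fun _ _ => rfl) (smulHom N (1 : Aᵐᵒᵖ)) _)
      (g := AddMonoidHom.id _) (fun m n => ?_) x
    change tmul S m ((1 : Aᵐᵒᵖ) • n) = tmul S m n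
    rw [one_smul]
  smul_zero t := map_zero (map (AddMonoidHom.id M) (fun _ _ => rfl) (smulHom N t)
    (fun s n => (smul_comm s t n).symm))
  zero_smul x := by
    refine hom_congr (f := map (AddMonoidHom.id M) (fun _ _ => rfl) (smulHom N (0 : Aᵐᵒᵖ)) _)
      (g := 0) (fun m n => ?_) x
    change tmul S m ((0 : Aᵐᵒᵖ) • n) = 0
    rw [zero_smul]
    exact map_zero (mk S m)

end Actions

/-- The canonical map `M ⊗_S (N ⊗_T P) → (M ⊗_S N) ⊗_T P`, `m ⊗ (n ⊗ p) ↦ (m ⊗ n) ⊗ p`. -/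
def assoc (S T M N P : Type*) [NonUnitalRing S] [NonUnitalRing T] [AddCommGroup M]
    [AddCommGroup N] [AddCommGroup P] [SMul Sᵐᵒᵖ M] [SMul S N] [NUModule S N] [SMul Tᵐᵒᵖ N]
    [NUModule Tᵐᵒᵖ N] [SMulCommClass S Tᵐᵒᵖ N] [SMul T P] :
    Tens S M (Tens T N P) →+ Tens T (Tens S M N) P :=
  lift
    (AddMonoidHom.mk' (fun m => map (mk S m) (fun t n => (op_smul_tmul (op t) m n).symm)
        (AddMonoidHom.id P) (fun _ _ => rfl))
      (fun m m' => hom_ext (fun n p => by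
        change tmul T (tmul S (m + m') n) p = tmul T (tmul S m n) p + tmul T (tmul S m' n) p
        rw [add_tmul, add_tmul])))
    (fun s m x => by
      refine hom_congr
        (f := map (mk S (op s • m)) (fun t n => (op_smul_tmul (op t) (op s • m) n).symm)
          (AddMonoidHom.id P) (fun _ _ => rfl))
        (g := (map (mk S m) (fun t n => (op_smul_tmul (op t) m n).symm)
          (AddMonoidHom.id P) (fun _ _ => rfl)).comp
          (map (smulHom N s) (fun t n => smul_comm s (op t) n) (AddMonoidHom.id P)
            (fun _ _ => rfl))) (fun n p => ?_) x
      change tmul T (tmul S (op s • m) n) p = tmul T (tmul S m (s • n)) p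
      rw [smul_tmul])

@[simp] theorem assoc_tmul {S T M N P : Type*} [NonUnitalRing S] [NonUnitalRing T]
    [AddCommGroup M]
    [AddCommGroup N] [AddCommGroup P] [SMul Sᵐᵒᵖ M] [SMul S N] [NUModule S N] [SMul Tᵐᵒᵖ N]
    [NUModule Tᵐᵒᵖ N] [SMulCommClass S Tᵐᵒᵖ N] [SMul T P] (m : M) (n : N) (p : P) :
    assoc S T M N P (tmul S m (tmul T n p)) = tmul T (tmul S m n) p := rfl

/-- For a left linear map `e : N → S`, the map `M ⊗_S N → M`, `m ⊗ n ↦ m e(n)`; that is, `M ⊗ e`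
followed by the multiplication `M ⊗_S S → M`. -/
def evalRight {S M N : Type*} [NonUnitalRing S] [AddCommGroup M] [AddCommGroup N]
    [SMul Sᵐᵒᵖ M] [NUModule Sᵐᵒᵖ M] [SMul S N] (e : N →+ S)
    (he : ∀ (s : S) n, e (s • n) = s * e n) : Tens S M N →+ M :=
  lift (AddMonoidHom.mk' (fun m => AddMonoidHom.mk' (fun n => op (e n) • m)
      (fun n n' => by rw [map_add]; exact NUModule.add_smul (op (e n)) (op (e n')) m))
      (fun m m' => by ext n; exact NUModule.smul_add _ _ _))
    (fun s m n => by
      change op (e n) • (op s • m) = op (e (s • n)) • m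
      rw [he, op_mul, NUModule.mul_smul])

/-- For a right linear map `e : M → S`, the map `M ⊗_S N → N`, `m ⊗ n ↦ e(m) n`; that is, `e ⊗ N`
followed by the multiplication `S ⊗_S N → N`. -/
def evalLeft {S M N : Type*} [NonUnitalRing S] [AddCommGroup M] [AddCommGroup N]
    [SMul Sᵐᵒᵖ M] [SMul S N] [NUModule S N] (e : M →+ S)
    (he : ∀ (s : S) m, e (op s • m) = e m * s) : Tens S M N →+ N :=
  lift (AddMonoidHom.mk' (fun m => AddMonoidHom.mk' (fun n => e m • n)
      (fun n n' => NUModule.smul_add _ _ _))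
      (fun m m' => by
        ext n
        change e (m + m') • n = e m • n + e m' • n
        rw [map_add, NUModule.add_smul]))
    (fun s m n => by
      change e (op s • m) • n = e m • (s • n)
      rw [he, NUModule.mul_smul])

end Tens

/-! ### Firm modules and firm rings -/

/-- The multiplication map `M ⊗_R R → M`, `m ⊗ r ↦ m r`. -/
def mulRight (R M : Type*) [NonUnitalRing R] [AddCommGroup M] [SMul Rᵐᵒᵖ M] [NUModule Rᵐᵒᵖ M] :
    Tens R M R →+ M :=
  Tens.evalRight (AddMonoidHom.id R) (fun _ _ => rfl)

/-- The multiplication map `R ⊗_R M → M`, `r ⊗ m ↦ r m`. -/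
def mulLeft (R M : Type*) [NonUnitalRing R] [AddCommGroup M] [SMul R M] [NUModule R M] :
    Tens R R M →+ M :=
  Tens.evalLeft (AddMonoidHom.id R) (fun _ _ => rfl)

/-- `R` is a firm ring: multiplication `R ⊗_R R → R` is an isomorphism. -/
class IsFirmRing (R : Type*) [NonUnitalRing R] : Prop where
  bijective : Function.Bijective (mulRight R R)

/-- Right modules over the non-unital ring `R`, not necessarily firm. -/
structure RMod (R : Type u) [NonUnitalRing R] : Type (u + 1) where
  carrier : Type u
  [addCommGroup : AddCommGroup carrier]
  [smul : SMul Rᵐᵒᵖ carrier]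
  [nuModule : NUModule Rᵐᵒᵖ carrier]

attribute [instance] RMod.addCommGroup RMod.smul RMod.nuModule

namespace RMod

variable {R : Type u} [NonUnitalRing R]

/-- Right `R`-linear maps. -/
@[ext] structure Hom (M N : RMod R) : Type u where
  toAddHom : M.carrier →+ N.carrier
  map_op_smul : ∀ (r : R) (m : M.carrier), toAddHom (op r • m) = op r • toAddHom m

instance : Category (RMod R) where
  Hom := Hom
  id M := ⟨AddMonoidHom.id _, fun _ _ => rfl⟩
  comp f g := ⟨g.toAddHom.comp f.toAddHom, fun r m => by
    simp [f.map_op_smul, g.map_op_smul]⟩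

/-- A right module is firm if multiplication `M ⊗_R R → M` is an isomorphism. -/
def isFirm (R : Type u) [NonUnitalRing R] : ObjectProperty (RMod R) :=
  fun M => Function.Bijective (mulRight R M.carrier)

end RMod

/-- The category of firm right `R`-modules and right `R`-linear maps. -/
abbrev FirmMod (R : Type u) [NonUnitalRing R] := (RMod.isFirm R).FullSubcategory

/-- The firm ring `R` as an object of the category of firm right `R`-modules. -/
def FirmMod.self (R : Type u) [NonUnitalRing R] [IsFirmRing R] : FirmMod R :=
  ⟨⟨R⟩, IsFirmRing.bijective⟩

/-- Left multiplication by `r`, as an endomorphism of the right module `R`. -/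
def FirmMod.lmul (R : Type u) [NonUnitalRing R] [IsFirmRing R] (r : R) :
    FirmMod.self R ⟶ FirmMod.self R :=
  ObjectProperty.homMk
    (show RMod.Hom ⟨R⟩ ⟨R⟩ from ⟨AddMonoidHom.mulLeft r, fun s m => (mul_assoc r m s).symm⟩)

/-- For a firm ring `R` and a right `R`-module `X`, the module `X ⊗_R R` is firm. -/
theorem isFirm_tensor (R : Type u) [NonUnitalRing R] [IsFirmRing R] (X : RMod R) :
    RMod.isFirm R ⟨Tens R X.carrier R⟩ := by
  have hlin : ∀ (s : R) (y : Tens R R R), mulRight R R (s • y) = s • mulRight R R y :=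
    fun s y => Tens.hom_congr
      (f := (mulRight R R).comp (Tens.map (smulHom R s) (fun t n => smul_comm s (op t) n)
        (AddMonoidHom.id R) (fun _ _ => rfl)))
      (g := (smulHom R s).comp (mulRight R R)) (fun a b => mul_assoc s a b) y
  let e : Tens R R R ≃+ R := AddEquiv.ofBijective (mulRight R R) IsFirmRing.bijective
  have he : ∀ y, e y = mulRight R R y := fun _ => rfl
  have hd : ∀ (s r : R), e.symm.toAddMonoidHom (s • r) = s • e.symm.toAddMonoidHom r := by
    intro s r
    apply e.injective
    change e (e.symm (s • r)) = mulRight R R (s • e.symm r)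
    rw [hlin, ← he, e.apply_symm_apply, e.apply_symm_apply]
  let g : Tens R X.carrier R →+ Tens R (Tens R X.carrier R) R :=
    (Tens.assoc R R X.carrier R R).comp
      (Tens.map (AddMonoidHom.id X.carrier) (fun _ _ => rfl) e.symm.toAddMonoidHom hd)
  have hcomp : ∀ (x : X.carrier) (y : Tens R R R), mulRight R (Tens R X.carrier R)
      (Tens.assoc R R X.carrier R R (Tens.tmul R x y)) = Tens.tmul R x (mulRight R R y) :=
    fun x y => Tens.hom_congr (f := ((mulRight R (Tens R X.carrier R)).comp
      (Tens.assoc R R X.carrier R R)).comp (Tens.mk R x))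
      (g := (Tens.mk R x).comp (mulRight R R)) (fun a b => rfl) y
  refine Function.bijective_iff_has_inverse.2 ⟨g, fun z => ?_, fun z => ?_⟩
  · refine Tens.hom_congr (f := g.comp (mulRight R (Tens R X.carrier R)))
      (g := AddMonoidHom.id _) (fun w s => ?_) z
    refine Tens.hom_congr
      (f := (g.comp (mulRight R (Tens R X.carrier R))).comp ((Tens.mk R).flip s))
      (g := (Tens.mk R).flip s) (fun x r => ?_) w
    change Tens.assoc R R X.carrier R R (Tens.tmul R x (e.symm (e (Tens.tmul R r s)))) = _
    rw [e.symm_apply_apply]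
    rfl
  · refine Tens.hom_congr (f := (mulRight R (Tens R X.carrier R)).comp g)
      (g := AddMonoidHom.id _) (fun x r => ?_) z
    change mulRight R (Tens R X.carrier R)
      (Tens.assoc R R X.carrier R R (Tens.tmul R x (e.symm r))) = Tens.tmul R x r
    rw [hcomp, ← he, e.apply_symm_apply]

/-- The functor `- ⊗_R R` from right `R`-modules to firm right `R`-modules. -/
def firmification (R : Type u) [NonUnitalRing R] [IsFirmRing R] : RMod R ⥤ FirmMod R where
  obj X := ⟨⟨Tens R X.carrier R⟩, isFirm_tensor R X⟩
  map {X Y} f := ObjectProperty.homMk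
    (show RMod.Hom ⟨Tens R X.carrier R⟩ ⟨Tens R Y.carrier R⟩ from
      ⟨Tens.map f.toAddHom f.map_op_smul (AddMonoidHom.id R) (fun _ _ => rfl),
        fun r x => Tens.hom_congr
          (f := (Tens.map f.toAddHom f.map_op_smul (AddMonoidHom.id R) (fun _ _ => rfl)).comp
            (smulHom (Tens R X.carrier R) (op r)))
          (g := (smulHom (Tens R Y.carrier R) (op r)).comp
            (Tens.map f.toAddHom f.map_op_smul (AddMonoidHom.id R) (fun _ _ => rfl)))
          (fun _ _ => rfl) x⟩)
  map_id X := by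
    apply ObjectProperty.hom_ext
    exact RMod.Hom.ext (Tens.hom_ext fun _ _ => rfl)
  map_comp f g := by
    apply ObjectProperty.hom_ext
    exact RMod.Hom.ext (Tens.hom_ext fun _ _ => rfl)

/-! ### Corings and comodules -/

/-- An `A`-coring structure on the `A`-bimodule `C`. -/
class Coring (A : Type u) [Ring A] (C : Type u) [AddCommGroup C] [Module A C] [Module Aᵐᵒᵖ C]
    [SMulCommClass A Aᵐᵒᵖ C] where
  comul : C →+ Tens A C C
  comul_smul : ∀ (a : A) (c : C), comul (a • c) = a • comul c
  comul_op_smul : ∀ (a : A) (c : C), comul (op a • c) = op a • comul c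
  counit : C →+ A
  counit_smul : ∀ (a : A) (c : C), counit (a • c) = a * counit c
  counit_op_smul : ∀ (a : A) (c : C), counit (op a • c) = counit c * a
  coassoc : ∀ c : C,
    Tens.assoc A A C C C (Tens.map (AddMonoidHom.id C) (fun _ _ => rfl) comul comul_smul (comul c))
      = Tens.map comul comul_op_smul (AddMonoidHom.id C) (fun _ _ => rfl) (comul c)
  counit_left : ∀ c : C, Tens.evalLeft counit counit_op_smul (comul c) = c
  counit_right : ∀ c : C, Tens.evalRight counit counit_smul (comul c) = c

section Comodules

variable (A : Type u) [Ring A] (C : Type u) [AddCommGroup C] [Module A C] [Module Aᵐᵒᵖ C]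
  [SMulCommClass A Aᵐᵒᵖ C]

/-- The map `f ⊗_A C` for a right `A`-linear map `f`. -/
def tensorCoring {A : Type u} [Ring A] (C : Type u) [AddCommGroup C] [Module A C]
    {M N : Type u} [AddCommGroup M] [AddCommGroup N]
    [Module Aᵐᵒᵖ M] [Module Aᵐᵒᵖ N] (f : M →ₗ[Aᵐᵒᵖ] N) : Tens A M C →+ Tens A N C :=
  Tens.map f.toAddMonoidHom (fun a m => f.map_smul (op a) m) (AddMonoidHom.id C) (fun _ _ => rfl)

theorem tensorCoring_comp {A : Type u} [Ring A] {C : Type u} [AddCommGroup C] [Module A C]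
    {M N P : Type u} [AddCommGroup M] [AddCommGroup N] [AddCommGroup P]
    [Module Aᵐᵒᵖ M] [Module Aᵐᵒᵖ N] [Module Aᵐᵒᵖ P] (g : N →ₗ[Aᵐᵒᵖ] P) (f : M →ₗ[Aᵐᵒᵖ] N)
    (x : Tens A M C) : tensorCoring C (g ∘ₗ f) x = tensorCoring C g (tensorCoring C f x) :=
  Tens.hom_congr (f := tensorCoring C (g ∘ₗ f)) (g := (tensorCoring C g).comp (tensorCoring C f))
    (fun _ _ => rfl) x

theorem tensorCoring_smul {A : Type u} [Ring A] {C : Type u} [AddCommGroup C] [Module A C]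
    [Module Aᵐᵒᵖ C] [SMulCommClass A Aᵐᵒᵖ C] {M N : Type u} [AddCommGroup M] [AddCommGroup N]
    [Module Aᵐᵒᵖ M] [Module Aᵐᵒᵖ N] (f : M →ₗ[Aᵐᵒᵖ] N) (a : Aᵐᵒᵖ) (x : Tens A M C) :
    tensorCoring C f (a • x) = a • tensorCoring C f x :=
  Tens.hom_congr (f := (tensorCoring C f).comp (smulHom _ a))
    (g := (smulHom _ a).comp (tensorCoring C f)) (fun _ _ => rfl) x

/-- The map `f ⊗_A C`, as a right `A`-linear map. -/
def tensorCoringLin {A : Type u} [Ring A] (C : Type u) [AddCommGroup C] [Module A C]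
    [Module Aᵐᵒᵖ C] [SMulCommClass A Aᵐᵒᵖ C] {M N : Type u} [AddCommGroup M] [AddCommGroup N]
    [Module Aᵐᵒᵖ M] [Module Aᵐᵒᵖ N] (f : M →ₗ[Aᵐᵒᵖ] N) : Tens A M C →ₗ[Aᵐᵒᵖ] Tens A N C where
  toFun := tensorCoring C f
  map_add' := map_add _
  map_smul' := tensorCoring_smul f

variable [Coring A C]

theorem coassoc_tensorCoring {A : Type u} [Ring A] {C : Type u} [AddCommGroup C] [Module A C]
    [Module Aᵐᵒᵖ C] [SMulCommClass A Aᵐᵒᵖ C] [Coring A C] {M N : Type u} [AddCommGroup M]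
    [AddCommGroup N] [Module Aᵐᵒᵖ M] [Module Aᵐᵒᵖ N] (f : M →ₗ[Aᵐᵒᵖ] N) (x : Tens A M C) :
    Tens.assoc A A N C C (Tens.map (AddMonoidHom.id N) (fun _ _ => rfl)
        Coring.comul Coring.comul_smul (tensorCoring C f x))
      = tensorCoring C (tensorCoringLin C f) (Tens.assoc A A M C C
        (Tens.map (AddMonoidHom.id M) (fun _ _ => rfl) Coring.comul Coring.comul_smul x)) := by
  refine Tens.hom_congr
    (f := ((Tens.assoc A A N C C).comp (Tens.map (AddMonoidHom.id N) (fun _ _ => rfl)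
      Coring.comul Coring.comul_smul)).comp (tensorCoring C f))
    (g := (tensorCoring C (tensorCoringLin C f)).comp ((Tens.assoc A A M C C).comp
        (Tens.map (AddMonoidHom.id M) (fun _ _ => rfl) Coring.comul Coring.comul_smul)))
    (fun m c => ?_) x
  exact Tens.hom_congr
    (f := (Tens.assoc A A N C C).comp (Tens.mk A (f m)))
    (g := (tensorCoring C (tensorCoringLin C f)).comp ((Tens.assoc A A M C C).comp
      (Tens.mk A m))) (fun _ _ => rfl) (Coring.comul c)

/-- Right `C`-comodules: right `A`-modules `M` with a right `A`-linear, coassociative and counital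
coaction `M → M ⊗_A C`. -/
structure Comod : Type (u + 1) where
  carrier : Type u
  [addCommGroup : AddCommGroup carrier]
  [module : Module Aᵐᵒᵖ carrier]
  coact : carrier →ₗ[Aᵐᵒᵖ] Tens A carrier C
  coassoc : ∀ m : carrier,
    Tens.assoc A A carrier C C (Tens.map (AddMonoidHom.id carrier) (fun _ _ => rfl)
        Coring.comul Coring.comul_smul (coact m))
      = Tens.map coact.toAddMonoidHom (fun a m => coact.map_smul (op a) m)
        (AddMonoidHom.id C) (fun _ _ => rfl) (coact m)
  counit : ∀ m : carrier, Tens.evalRight Coring.counit Coring.counit_smul (coact m) = m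

attribute [instance] Comod.addCommGroup Comod.module

variable {A C}

namespace Comod

/-- The group `Hom^C(M, N)` of right `C`-colinear maps. -/
def colinear (M N : Comod A C) : AddSubgroup (M.carrier →ₗ[Aᵐᵒᵖ] N.carrier) where
  carrier := {f | ∀ m, N.coact (f m) = tensorCoring C f (M.coact m)}
  zero_mem' m := by
    change N.coact 0 = _
    rw [map_zero]
    refine (Tens.hom_congr (f := tensorCoring C (0 : M.carrier →ₗ[Aᵐᵒᵖ] N.carrier)) (g := 0)
      (fun m c => ?_) (M.coact m)).symm
    exact map_zero ((Tens.mk A).flip c)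
  add_mem' {f g} hf hg m := by
    change N.coact (f m + g m) = _
    rw [map_add, hf m, hg m]
    refine (Tens.hom_congr (f := tensorCoring C (f + g))
      (g := tensorCoring C f + tensorCoring C g) (fun m c => ?_) (M.coact m)).symm
    exact Tens.add_tmul (f m) (g m) c
  neg_mem' {f} hf m := by
    change N.coact (- f m) = _
    rw [map_neg, hf m]
    refine (Tens.hom_congr (f := tensorCoring C (-f))
      (g := - tensorCoring C f) (fun m c => ?_) (M.coact m)).symm
    exact map_neg ((Tens.mk A).flip c) (f m)

/-- The category of right `C`-comodules and colinear maps. -/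
instance : Category (Comod A C) where
  Hom M N := colinear M N
  id M := ⟨LinearMap.id, fun m =>
    (Tens.hom_congr (f := tensorCoring C (LinearMap.id : M.carrier →ₗ[Aᵐᵒᵖ] M.carrier))
      (g := AddMonoidHom.id _) (fun _ _ => rfl) (M.coact m)).symm⟩
  comp {M N P} f g := ⟨g.1 ∘ₗ f.1, fun m => by
    rw [tensorCoring_comp, ← f.2 m, ← g.2 (f.1 m)]; rfl⟩

instance : Preadditive (Comod A C) where
  homGroup M N := inferInstanceAs (AddCommGroup (colinear M N))
  add_comp _ _ _ f f' g := Subtype.ext (LinearMap.ext fun m => map_add g.1 (f.1 m) (f'.1 m))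
  comp_add _ _ _ _ _ _ := rfl

end Comod

end Comodules

/-! ### Bicomodules and the functors attached to them -/

section Bicomodules

variable (R : Type u) [NonUnitalRing R]
variable (A : Type u) [Ring A] (C : Type u) [AddCommGroup C] [Module A C] [Module Aᵐᵒᵖ C]
  [SMulCommClass A Aᵐᵒᵖ C] [Coring A C]

/-- Right `C`-comodules with a left `R`-module structure that commutes with the right `A`-action
and for which the coaction is left `R`-linear. -/
structure Bicomod extends Comod A C where
  [smul : SMul R carrier]
  [nuModule : NUModule R carrier]
  [smulComm : SMulCommClass R Aᵐᵒᵖ carrier]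
  coact_smul : ∀ (r : R) (m : carrier), coact (r • m) = r • coact m

attribute [instance] Bicomod.smul Bicomod.nuModule Bicomod.smulComm

variable {R A C}

namespace Bicomod

/-- The left `R`-module `Σ` is firm: multiplication `R ⊗_R Σ → Σ` is an isomorphism. Objects of
the category of `R`-`C`-bicomodules over a firm ring `R` are required to be firm. -/
def IsFirm (B : Bicomod R A C) : Prop := Function.Bijective (mulLeft R B.carrier)

/-- Left multiplication by `r` is colinear. -/
def lmul (B : Bicomod R A C) (r : R) : B.toComod ⟶ B.toComod :=
  ⟨{ toFun := fun m => r • m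
     map_add' := NUModule.smul_add r
     map_smul' := fun a m => smul_comm r a m }, fun m => B.coact_smul r m⟩

/-- A ring morphism `R → End^C(X)` turns the comodule `X` into an `R`-`C`-bicomodule. -/
def ofHom (X : Comod A C) (j : R →ₙ+* End X) : Bicomod R A C :=
  letI : SMul R X.carrier := ⟨fun r m => (j r).1 m⟩
  haveI : NUModule R X.carrier :=
    { smul_add := fun r m n => map_add (j r).1 m n
      add_smul := fun r s m => by
        change (j (r + s)).1 m = _
        rw [map_add]; rfl
      mul_smul := fun r s m => by
        change (j (r * s)).1 m = _
        rw [map_mul]; rfl }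
  haveI : SMulCommClass R Aᵐᵒᵖ X.carrier := ⟨fun r a m => (j r).1.map_smul a m⟩
  { X with
    coact_smul := fun r m => (j r).2 m }

/-- The map `u ↦ m ⊗ u`. -/
def pureTensor (B : Bicomod R A C) (M : RMod R) (m : M.carrier) :
    B.carrier →ₗ[Aᵐᵒᵖ] Tens R M.carrier B.carrier where
  toFun := Tens.tmul R m
  map_add' := Tens.tmul_add m
  map_smul' a u := (Tens.op_smul_tmul a m u).symm

/-- The coaction of `M ⊗_R Σ`: the map `M ⊗_R ρ` followed by the canonical map
`M ⊗_R (Σ ⊗_A C) → (M ⊗_R Σ) ⊗_A C`. -/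
def tensorCoact (B : Bicomod R A C) (M : RMod R) :
    Tens R M.carrier B.carrier →+ Tens A (Tens R M.carrier B.carrier) C :=
  (Tens.assoc R A M.carrier B.carrier C).comp
    (Tens.map (AddMonoidHom.id M.carrier) (fun _ _ => rfl)
      B.coact.toAddMonoidHom B.coact_smul)

theorem tensorCoact_tmul (B : Bicomod R A C) (M : RMod R) (m : M.carrier) (u : B.carrier) :
    B.tensorCoact M (Tens.tmul R m u) = tensorCoring C (B.pureTensor M m) (B.coact u) := rfl

/-- The coaction of `M ⊗_R Σ`, as a right `A`-linear map. -/
def tensorCoactLin (B : Bicomod R A C) (M : RMod R) :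
    Tens R M.carrier B.carrier →ₗ[Aᵐᵒᵖ] Tens A (Tens R M.carrier B.carrier) C where
  toFun := B.tensorCoact M
  map_add' := map_add _
  map_smul' a x := by
    refine Tens.hom_congr (f := (B.tensorCoact M).comp (smulHom _ a))
      (g := (smulHom (Tens A (Tens R M.carrier B.carrier) C) a).comp (B.tensorCoact M))
      (fun m u => ?_) x
    change tensorCoring C (B.pureTensor M m) (B.coact (a • u))
      = a • tensorCoring C (B.pureTensor M m) (B.coact u)
    rw [map_smul, tensorCoring_smul]

theorem tensorCoact_pure (B : Bicomod R A C) (M : RMod R) (m : M.carrier) (y : Tens A B.carrier C) :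
    tensorCoring C (B.tensorCoactLin M) (tensorCoring C (B.pureTensor M m) y)
      = tensorCoring C (tensorCoringLin C (B.pureTensor M m)) (tensorCoring C B.coact y) :=
  Tens.hom_congr
    (f := (tensorCoring C (B.tensorCoactLin M)).comp (tensorCoring C (B.pureTensor M m)))
    (g := (tensorCoring C (tensorCoringLin C (B.pureTensor M m))).comp (tensorCoring C B.coact))
    (fun _ _ => rfl) y

theorem tensor_coassoc (B : Bicomod R A C) (M : RMod R) (x : Tens R M.carrier B.carrier) :
    Tens.assoc A A (Tens R M.carrier B.carrier) C C
        (Tens.map (AddMonoidHom.id (Tens R M.carrier B.carrier)) (fun _ _ => rfl)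
          Coring.comul Coring.comul_smul (B.tensorCoact M x))
      = tensorCoring C (B.tensorCoactLin M) (B.tensorCoact M x) := by
  refine Tens.hom_congr
    (f := ((Tens.assoc A A (Tens R M.carrier B.carrier) C C).comp
      (Tens.map (AddMonoidHom.id (Tens R M.carrier B.carrier)) (fun _ _ => rfl)
        Coring.comul Coring.comul_smul)).comp (B.tensorCoact M))
    (g := (tensorCoring C (B.tensorCoactLin M)).comp (B.tensorCoact M)) (fun m u => ?_) x
  refine (coassoc_tensorCoring (B.pureTensor M m) (B.coact u)).trans ?_
  rw [B.coassoc u]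
  exact (B.tensorCoact_pure M m (B.coact u)).symm

theorem counit_pure (B : Bicomod R A C) (M : RMod R) (m : M.carrier) (y : Tens A B.carrier C) :
    Tens.evalRight Coring.counit Coring.counit_smul (tensorCoring C (B.pureTensor M m) y)
      = B.pureTensor M m (Tens.evalRight Coring.counit Coring.counit_smul y) :=
  Tens.hom_congr
    (f := (Tens.evalRight Coring.counit Coring.counit_smul).comp
      (tensorCoring C (B.pureTensor M m)))
    (g := (B.pureTensor M m).toAddMonoidHom.comp
      (Tens.evalRight Coring.counit Coring.counit_smul))
    (fun u c => (map_smul (B.pureTensor M m) (op (Coring.counit c)) u).symm) y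

theorem tensor_counit (B : Bicomod R A C) (M : RMod R) (x : Tens R M.carrier B.carrier) :
    Tens.evalRight Coring.counit Coring.counit_smul (B.tensorCoact M x) = x := by
  have h : (Tens.evalRight (Coring.counit : C →+ A) Coring.counit_smul).comp (B.tensorCoact M)
      = AddMonoidHom.id (Tens R M.carrier B.carrier) := Tens.hom_ext (fun m u => by
    rw [AddMonoidHom.comp_apply, tensorCoact_tmul, counit_pure, B.counit u]
    rfl)
  exact DFunLike.congr_fun h x

/-- The right `C`-comodule `M ⊗_R Σ`. -/
def tensorObj (B : Bicomod R A C) (M : RMod R) : Comod A C where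
  carrier := Tens R M.carrier B.carrier
  coact := B.tensorCoactLin M
  coassoc := B.tensor_coassoc M
  counit := B.tensor_counit M

/-- The map `f ⊗_R Σ`. -/
def tensorMap (B : Bicomod R A C) {M N : RMod R} (f : M ⟶ N) :
    Tens R M.carrier B.carrier →ₗ[Aᵐᵒᵖ] Tens R N.carrier B.carrier where
  toFun := Tens.map f.toAddHom f.map_op_smul (AddMonoidHom.id B.carrier) (fun _ _ => rfl)
  map_add' := map_add _
  map_smul' a x := Tens.hom_congr
    (f := (Tens.map f.toAddHom f.map_op_smul (AddMonoidHom.id B.carrier)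
      (fun _ _ => rfl)).comp (smulHom (Tens R M.carrier B.carrier) a))
    (g := (smulHom (Tens R N.carrier B.carrier) a).comp
      (Tens.map f.toAddHom f.map_op_smul (AddMonoidHom.id B.carrier) (fun _ _ => rfl)))
    (fun _ _ => rfl) x

theorem tensorMap_colinear (B : Bicomod R A C) {M N : RMod R} (f : M ⟶ N)
    (x : Tens R M.carrier B.carrier) :
    B.tensorCoact N (B.tensorMap f x) = tensorCoring C (B.tensorMap f) (B.tensorCoact M x) := by
  refine Tens.hom_congr
    (f := (B.tensorCoact N).comp (B.tensorMap f).toAddMonoidHom)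
    (g := (tensorCoring C (B.tensorMap f)).comp (B.tensorCoact M)) (fun m u => ?_) x
  exact Tens.hom_congr (f := tensorCoring C (B.pureTensor N (f.toAddHom m)))
    (g := (tensorCoring C (B.tensorMap f)).comp (tensorCoring C (B.pureTensor M m)))
    (fun _ _ => rfl) (B.coact u)

/-- The functor `- ⊗_R Σ` from (not necessarily firm) right `R`-modules to right `C`-comodules. -/
def tensor (B : Bicomod R A C) : RMod R ⥤ Comod A C where
  obj := B.tensorObj
  map f := ⟨B.tensorMap f, B.tensorMap_colinear f⟩
  map_id M := Subtype.ext (LinearMap.toAddMonoidHom_injective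
    (Tens.hom_ext (f := (B.tensorMap (𝟙 M)).toAddMonoidHom) (g := AddMonoidHom.id _)
      fun _ _ => rfl))
  map_comp f g := Subtype.ext (LinearMap.toAddMonoidHom_injective
    (Tens.hom_ext (f := (B.tensorMap (f ≫ g)).toAddMonoidHom)
      (g := (B.tensorMap g).toAddMonoidHom.comp (B.tensorMap f).toAddMonoidHom)
      fun _ _ => rfl))

/-- The functor `- ⊗_R Σ` from firm right `R`-modules to right `C`-comodules. -/
abbrev tensorFirm (B : Bicomod R A C) : FirmMod R ⥤ Comod A C :=
  (RMod.isFirm R).ι ⋙ B.tensor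

/-- The functor `Hom^C(Σ, -)` from right `C`-comodules to right `R`-modules, where
`(f r)(u) = f(r u)`. -/
def homComod (B : Bicomod R A C) : Comod A C ⥤ RMod R where
  obj N :=
    letI : SMul Rᵐᵒᵖ (B.toComod ⟶ N) := ⟨fun r f => B.lmul r.unop ≫ f⟩
    { carrier := B.toComod ⟶ N
      nuModule :=
        { smul_add := fun r f g => Preadditive.comp_add _ _ _ _ _ _
          add_smul := fun r s f => Subtype.ext (LinearMap.ext fun m => by
            change f.1 ((r.unop + s.unop) • m) = f.1 (r.unop • m) + f.1 (s.unop • m)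
            rw [NUModule.add_smul, map_add])
          mul_smul := fun r s f => Subtype.ext (LinearMap.ext fun m => by
            change f.1 ((s.unop * r.unop) • m) = f.1 (s.unop • (r.unop • m))
            rw [NUModule.mul_smul]) } }
  map {N P} g :=
    { toAddHom := AddMonoidHom.mk' (fun f => f ≫ g) (fun f f' => Preadditive.add_comp _ _ _ _ _ _)
      map_op_smul := fun _ _ => rfl }

/-- The functor `Hom^C(Σ, -) ⊗_R R` from right `C`-comodules to firm right `R`-modules. -/
abbrev homFirm [IsFirmRing R] (B : Bicomod R A C) : Comod A C ⥤ FirmMod R :=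
  B.homComod ⋙ firmification R

/-- The functor `Hom_A(Σ, -)` from right `A`-modules to right `R`-modules, where
`(f r)(u) = f(r u)`. -/
def homMod (B : Bicomod R A C) : ModuleCat.{u} Aᵐᵒᵖ ⥤ RMod R where
  obj M :=
    letI : SMul Rᵐᵒᵖ (B.carrier →ₗ[Aᵐᵒᵖ] M) := ⟨fun r f => f ∘ₗ (B.lmul r.unop).1⟩
    { carrier := B.carrier →ₗ[Aᵐᵒᵖ] M
      nuModule :=
        { smul_add := fun r f g => LinearMap.add_comp _ _ _
          add_smul := fun r s f => LinearMap.ext fun m => by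
            change f ((r.unop + s.unop) • m) = f (r.unop • m) + f (s.unop • m)
            rw [NUModule.add_smul, map_add]
          mul_smul := fun r s f => LinearMap.ext fun m => by
            change f ((s.unop * r.unop) • m) = f (s.unop • (r.unop • m))
            rw [NUModule.mul_smul] } }
  map {N P} g :=
    { toAddHom := AddMonoidHom.mk' (fun f => g.hom ∘ₗ f) (fun f f' => LinearMap.comp_add _ _ _)
      map_op_smul := fun _ _ => rfl }

end Bicomod

variable (A C)

/-- The coring `C` as an `A`-`C`-bicomodule, with coaction the comultiplication. -/
def coringBicomod : Bicomod A A C where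
  carrier := C
  coact :=
    { toFun := Coring.comul
      map_add' := map_add _
      map_smul' := fun a c => Coring.comul_op_smul a.unop c }
  coassoc := Coring.coassoc
  counit := Coring.counit_right
  coact_smul := Coring.comul_smul

/-- Unital right `A`-modules as modules over the underlying non-unital ring of `A`. -/
def forgetUnit : ModuleCat.{u} Aᵐᵒᵖ ⥤ RMod A where
  obj M := ⟨M⟩
  map f := ⟨f.hom.toAddMonoidHom, fun a m => f.hom.map_smul (op a) m⟩

/-- The functor `- ⊗_A C` from right `A`-modules to right `C`-comodules, with the coaction
`M ⊗_A Δ` on `M ⊗_A C`. -/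
abbrev cofree : ModuleCat.{u} Aᵐᵒᵖ ⥤ Comod A C :=
  forgetUnit A ⋙ (coringBicomod A C).tensor

end Bicomodules

end FirmCoring

open FirmCoring

/-!
All right `R`-modules are the unital modules over the unitization of `R`, and the firm ones are
coreflective among them through `- ⊗_R R`. So firm modules have colimits, and composing the
coreflection with the tensor-hom adjunction gives `- ⊗_R Σ ⊣ Hom^C(Σ, -) ⊗_R R`. A firm module
`M` is generated by copies of `R`, one for each element of `M`, subject to additivity in `M` and
balancedness over `R`. A right exact functor `F` that preserves direct sums carries this
presentation to `F(M)`, so maps `F(M) → X` are the right linear maps `M → Hom(F(R), X)`, as are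
maps `M ⊗_R F(R) → X`. Yoneda gives `F(M) ≅ M ⊗_R F(R)`.
-/

namespace FirmCoring

namespace RMod

variable {R : Type u} [NonUnitalRing R]

/-- The action of `R` on a right module `M`, as a morphism into the endomorphism ring. -/
def actionHom (M : RMod R) : Rᵐᵒᵖ →ₙ+* AddMonoid.End M.carrier where
  toFun := smulHom M.carrier
  map_mul' r s := AddMonoidHom.ext (NUModule.mul_smul r s)
  map_zero' := AddMonoidHom.ext fun m => by
    have h := NUModule.add_smul 0 (0 : Rᵐᵒᵖ) m
    rwa [add_zero, left_eq_add] at h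
  map_add' r s := AddMonoidHom.ext (NUModule.add_smul r s)

instance (M : RMod R) : Module (Unitization ℤ Rᵐᵒᵖ) M.carrier :=
  Module.compHom M.carrier
    (Unitization.lift { M.actionHom with map_smul' := map_zsmul M.actionHom }).toRingHom

theorem unitization_smul (M : RMod R) (a : Unitization ℤ Rᵐᵒᵖ) (m : M.carrier) :
    a • m = a.fst • m + a.snd • m :=
  congrArg (· + a.snd • m) (Int.cast_smul_eq_zsmul (AddMonoid.End M.carrier) a.fst m)

theorem inr_smul (M : RMod R) (r : Rᵐᵒᵖ) (m : M.carrier) :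
    (Unitization.inr r : Unitization ℤ Rᵐᵒᵖ) • m = r • m := by
  rw [unitization_smul, Unitization.fst_inr, Unitization.snd_inr, zero_smul, zero_add]

variable (R)

/-- Right `R`-modules as unital modules over the unitization of `Rᵐᵒᵖ`. -/
def toUnitization : RMod R ⥤ ModuleCat.{u} (Unitization ℤ Rᵐᵒᵖ) where
  obj M := ModuleCat.of _ M.carrier
  map f := ModuleCat.ofHom
    { f.toAddHom with
      map_smul' := fun a m => by
        change f.toAddHom (a • m) = a • f.toAddHom m
        rw [unitization_smul, unitization_smul, map_add, map_zsmul]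
        exact congrArg _ (f.map_op_smul a.snd.unop m) }

/-- `toUnitization` is bijective on morphisms. -/
def fullyFaithfulToUnitization : (toUnitization R).FullyFaithful where
  preimage {M N} f := RMod.Hom.mk f.hom.toAddMonoidHom fun r m =>
    (congrArg f.hom (inr_smul M (op r) m).symm).trans
      ((f.hom.map_smul _ m).trans (inr_smul N (op r) _))

variable {R}

/-- A unital module over the unitization of `Rᵐᵒᵖ` as a right `R`-module. -/
def ofUnitization (N : ModuleCat.{u} (Unitization ℤ Rᵐᵒᵖ)) : RMod R :=
  letI : SMul Rᵐᵒᵖ N := ⟨fun r n => (Unitization.inr r : Unitization ℤ Rᵐᵒᵖ) • n⟩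
  { carrier := N
    nuModule :=
      { smul_add := fun r => smul_add (Unitization.inr r : Unitization ℤ Rᵐᵒᵖ)
        add_smul := fun r s n =>
          (congrArg (· • n) (Unitization.inr_add ℤ r s)).trans (add_smul _ _ n)
        mul_smul := fun r s n =>
          (congrArg (· • n) (Unitization.inr_mul ℤ r s)).trans (mul_smul _ _ n) } }

theorem unitization_smul_ofUnitization (N : ModuleCat.{u} (Unitization ℤ Rᵐᵒᵖ))
    (a : Unitization ℤ Rᵐᵒᵖ) (n : (ofUnitization N).carrier) : a • n = a • (show N from n) := by
  have inl_fst : (Unitization.inl a.fst : Unitization ℤ Rᵐᵒᵖ) = (a.fst : Unitization ℤ Rᵐᵒᵖ) :=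
    map_intCast (Unitization.inlRingHom ℤ Rᵐᵒᵖ) a.fst
  refine (unitization_smul _ a n).trans ?_
  change a.fst • (show N from n) +
    (Unitization.inr a.snd : Unitization ℤ Rᵐᵒᵖ) • (show N from n) = _
  rw [← Int.cast_smul_eq_zsmul (Unitization ℤ Rᵐᵒᵖ), ← inl_fst, ← add_smul,
    Unitization.inl_fst_add_inr_snd_eq]

instance : (toUnitization R).IsEquivalence where
  faithful := (fullyFaithfulToUnitization R).faithful
  full := (fullyFaithfulToUnitization R).full
  essSurj := ⟨fun N => ⟨ofUnitization N, ⟨LinearEquiv.toModuleIso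
    { AddEquiv.refl N with map_smul' := unitization_smul_ofUnitization N }⟩⟩⟩

instance : Preadditive (RMod R) := .ofFullyFaithful (fullyFaithfulToUnitization R)

instance : HasColimits (RMod R) := Adjunction.has_colimits_of_equivalence (toUnitization R)

theorem isIso_of_bijective {M N : RMod R} (f : M ⟶ N) (hf : Function.Bijective f.toAddHom) :
    IsIso f := by
  let e := AddEquiv.ofBijective f.toAddHom hf
  refine ⟨RMod.Hom.mk e.symm.toAddMonoidHom fun r n => e.injective ?_,
    RMod.Hom.ext (AddMonoidHom.ext e.symm_apply_apply),
    RMod.Hom.ext (AddMonoidHom.ext e.apply_symm_apply)⟩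
  calc
    e (e.symm (op r • n)) = op r • e (e.symm n) := by
      rw [e.apply_symm_apply, e.apply_symm_apply]
    _ = e (op r • e.symm n) := (f.map_op_smul r _).symm

theorem mulRight_smul (M : RMod R) (r : R) (x : Tens R M.carrier R) :
    mulRight R M.carrier (op r • x) = op r • mulRight R M.carrier x :=
  Tens.hom_congr (f := (mulRight R M.carrier).comp (smulHom _ (op r)))
    (g := (smulHom _ (op r)).comp (mulRight R M.carrier))
    (fun m s => NUModule.mul_smul (op r) (op s) m) x

theorem mulRight_map {M N : RMod R} (f : M ⟶ N) (x : Tens R M.carrier R) :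
    mulRight R N.carrier (Tens.map f.toAddHom f.map_op_smul (AddMonoidHom.id R)
      (fun _ _ => rfl) x) = f.toAddHom (mulRight R M.carrier x) :=
  Tens.hom_congr
    (f := (mulRight R N.carrier).comp (Tens.map f.toAddHom f.map_op_smul (AddMonoidHom.id R)
      (fun _ _ => rfl)))
    (g := f.toAddHom.comp (mulRight R M.carrier)) (fun m r => (f.map_op_smul r m).symm) x

variable (R) [IsFirmRing R]

/-- The natural map `M ⊗_R R → M`, `m ⊗ r ↦ m r`. -/
def mulRightHom : firmification R ⋙ (isFirm R).ι ⟶ 𝟭 (RMod R) where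
  app M := RMod.Hom.mk (mulRight R M.carrier) M.mulRight_smul
  naturality _ _ f := RMod.Hom.ext (AddMonoidHom.ext (mulRight_map f))

variable {R}

instance (M : FirmMod R) : IsIso ((mulRightHom R).app M.obj) := isIso_of_bijective _ M.property

/-- Both sides send `m ⊗ r ⊗ s` to `m ⊗ r s`, since `m r ⊗ s = m ⊗ r s`. -/
theorem firmification_map_mulRightHom (M : RMod R) :
    (isFirm R).ι.map ((firmification R).map ((mulRightHom R).app M)) =
      (mulRightHom R).app ((firmification R).obj M).obj := by
  refine RMod.Hom.ext (Tens.hom_ext fun y s => ?_)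
  exact Tens.hom_congr (f := ((Tens.mk R).flip s).comp (mulRight R M.carrier))
    (g := smulHom (Tens R M.carrier R) (op s)) (fun m r => Tens.smul_tmul r m s) y

end RMod

section Coreflection

variable (R : Type u) [NonUnitalRing R] [IsFirmRing R]

/-- Firm modules are coreflective among all modules, with coreflection `M ↦ M ⊗_R R`. -/
noncomputable def firmificationAdj : (RMod.isFirm R).ι ⊣ firmification R where
  unit :=
    { app := fun M => ObjectProperty.homMk (inv ((RMod.mulRightHom R).app M.obj))
      naturality := fun M N f => (RMod.isFirm R).ι.map_injective <| by
        change f.hom ≫ inv ((RMod.mulRightHom R).app N.obj) =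
          inv ((RMod.mulRightHom R).app M.obj) ≫ (firmification R ⋙ (RMod.isFirm R).ι).map f.hom
        rw [IsIso.comp_inv_eq, Category.assoc, IsIso.eq_inv_comp]
        exact ((RMod.mulRightHom R).naturality f.hom).symm }
  counit := RMod.mulRightHom R
  left_triangle_components M := IsIso.inv_hom_id ((RMod.mulRightHom R).app M.obj)
  right_triangle_components M := (RMod.isFirm R).ι.map_injective <| by
    rw [Functor.map_comp, RMod.firmification_map_mulRightHom]
    exact IsIso.inv_hom_id _

noncomputable instance : Coreflective (RMod.isFirm R).ι where
  R := firmification R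
  adj := firmificationAdj R

instance : HasColimits (FirmMod R) := hasColimits_of_coreflective (RMod.isFirm R).ι

end Coreflection

theorem additive_of_preservesFiniteCoproducts {C D : Type*} [Category* C] [Category* D]
    [Preadditive C] [Preadditive D] [HasFiniteCoproducts C] (F : C ⥤ D)
    [PreservesFiniteCoproducts F] : F.Additive := by
  have : HasBinaryBiproducts C := .of_hasBinaryCoproducts
  have : HasZeroObject C := hasZeroObject_of_hasInitial_object
  have : HasInitial D := (IsInitial.isInitialObj F _ initialIsInitial).hasInitial
  have : HasZeroObject D := hasZeroObject_of_hasInitial_object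
  have : PreservesBinaryBiproducts F := preservesBinaryBiproducts_of_preservesBinaryCoproducts F
  exact Functor.additive_of_preservesBinaryBiproducts F

/-- The right `R`-module of morphisms `Y ⟶ X` under a ring morphism `j : R → End Y`, with
`f r = j r ≫ f`. -/
def homRMod {R : Type u} [NonUnitalRing R] {D : Type*} [Category.{u} D] [Preadditive D] {Y : D}
    (j : R →ₙ+* End Y) (X : D) : RMod R :=
  letI : SMul Rᵐᵒᵖ (Y ⟶ X) := ⟨fun r f => j r.unop ≫ f⟩
  { carrier := Y ⟶ X
    nuModule :=
      { smul_add := fun _ f g => Preadditive.comp_add _ _ _ _ f g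
        add_smul := fun r s f =>
          (congrArg (· ≫ f) (map_add j r.unop s.unop)).trans (Preadditive.add_comp _ _ _ _ _ f)
        mul_smul := fun r s f =>
          (congrArg (· ≫ f) (map_mul j s.unop r.unop)).trans (Category.assoc _ _ f) } }

namespace FirmMod

variable {R : Type u} [NonUnitalRing R] [IsFirmRing R]

/-- The right linear map `R → M`, `r ↦ m r`. -/
def orbit (M : FirmMod R) (m : M.obj.carrier) : self R ⟶ M :=
  ObjectProperty.homMk (show RMod.Hom ⟨R⟩ M.obj from
    ⟨AddMonoidHom.mk' (fun r => op r • m) fun r s => NUModule.add_smul (op r) (op s) m,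
      fun r s => NUModule.mul_smul (op r) (op s) m⟩)

theorem orbit_add (M : FirmMod R) (m m' : M.obj.carrier) :
    orbit M (m + m') = orbit M m + orbit M m' :=
  ObjectProperty.hom_ext _ (RMod.Hom.ext (AddMonoidHom.ext fun (r : R) =>
    NUModule.smul_add (op r) m m'))

theorem orbit_smul (M : FirmMod R) (r : R) (m : M.obj.carrier) :
    orbit M (op r • m) = lmul R r ≫ orbit M m :=
  ObjectProperty.hom_ext _ (RMod.Hom.ext (AddMonoidHom.ext fun (s : R) =>
    (NUModule.mul_smul (op s) (op r) m).symm))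

theorem orbit_comp {M N : FirmMod R} (m : M.obj.carrier) (f : M ⟶ N) :
    orbit M m ≫ f = orbit N (f.hom.toAddHom m) :=
  ObjectProperty.hom_ext _ (RMod.Hom.ext (AddMonoidHom.ext fun r => f.hom.map_op_smul r m))

variable {D : Type*} [Category.{u} D] [Preadditive D]

/-- The action of `R` on `F(R)` through left multiplications. -/
def selfAction (F : FirmMod R ⥤ D) [F.Additive] : R →ₙ+* End (F.obj (self R)) where
  toFun r := F.map (lmul R r)
  map_mul' r s := by
    rw [End.mul_def, ← F.map_comp]
    exact congrArg F.map (orbit_smul (self R) s r)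
  map_zero' := by
    have lmul_zero : lmul R 0 = 0 :=
      ObjectProperty.hom_ext _ (RMod.Hom.ext (AddMonoidHom.ext fun (s : R) => zero_mul s))
    rw [lmul_zero, F.map_zero]
  map_add' r s := (congrArg F.map (orbit_add (self R) r s)).trans F.map_add

/-- The right linear map `m ↦ F(r ↦ m r) ≫ f` associated with `f : F(M) → X`. -/
def precompOrbit (F : FirmMod R ⥤ D) [F.Additive] (M : FirmMod R) (X : D) (f : F.obj M ⟶ X) :
    M.obj ⟶ homRMod (selfAction F) X :=
  RMod.Hom.mk
    (AddMonoidHom.mk' (fun m => (F.map (orbit M m) ≫ f : F.obj (self R) ⟶ X)) fun m m' => by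
      rw [orbit_add, F.map_add]
      exact Preadditive.add_comp _ _ _ _ _ _)
    fun r m => by
      change F.map (orbit M (op r • m)) ≫ f = F.map (lmul R r) ≫ F.map (orbit M m) ≫ f
      rw [orbit_smul, F.map_comp, Category.assoc]

/-- The right linear map `M ⊗_R R → N`, `m ⊗ r ↦ k(m)(r)`. -/
def uncurry {M : RMod R} {N : FirmMod R} (k : M ⟶ homRMod (selfAction (𝟭 (FirmMod R))) N) :
    (firmification R).obj M ⟶ N :=
  let eval : M.carrier →+ R →+ N.obj.carrier :=
    AddMonoidHom.mk' (fun m => (show self R ⟶ N from k.toAddHom m).hom.toAddHom) fun m m' =>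
      congrArg (fun f : self R ⟶ N => f.hom.toAddHom) (map_add k.toAddHom m m')
  let l : Tens R M.carrier R →+ N.obj.carrier := Tens.lift eval fun r m s =>
    congrArg (fun f : self R ⟶ N => f.hom.toAddHom s) (k.map_op_smul r m)
  ObjectProperty.homMk (show RMod.Hom ⟨Tens R M.carrier R⟩ N.obj from
    ⟨l, fun r => Tens.hom_congr (f := l.comp (smulHom _ (op r))) (g := (smulHom _ (op r)).comp l)
      fun m => (show self R ⟶ N from k.toAddHom m).hom.map_op_smul r⟩)

theorem precompOrbit_id_bijective (M N : FirmMod R) :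
    Function.Bijective (precompOrbit (𝟭 (FirmMod R)) M N) := by
  refine ⟨fun f g hfg => ?_, fun k => ?_⟩
  · refine ObjectProperty.hom_ext _ (RMod.Hom.ext (AddMonoidHom.ext fun m => ?_))
    obtain ⟨x, rfl⟩ := M.property.2 m
    exact Tens.hom_congr (f := f.hom.toAddHom.comp (mulRight R M.obj.carrier))
      (g := g.hom.toAddHom.comp (mulRight R M.obj.carrier)) (fun m r =>
      congrArg (fun h : M.obj ⟶ homRMod (selfAction (𝟭 (FirmMod R))) N =>
        (show self R ⟶ N from h.toAddHom m).hom.toAddHom r) hfg) x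
  · refine ⟨(firmificationAdj R).unit.app M ≫ uncurry k, RMod.Hom.ext (AddMonoidHom.ext fun m =>
      ObjectProperty.hom_ext _ (RMod.Hom.ext (AddMonoidHom.ext fun (r : R) => ?_)))⟩
    have unit_smul : ((firmificationAdj R).unit.app M).hom.toAddHom (op r • m) = Tens.tmul R m r :=
      congrArg (fun f : RMod.Hom _ _ => f.toAddHom (Tens.tmul R m r))
        (IsIso.hom_inv_id ((RMod.mulRightHom R).app M.obj))
    exact congrArg (uncurry k).hom.toAddHom unit_smul

variable (M : FirmMod R)

/-- The direct sum of copies of `R` indexed by the elements of `M`. -/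
noncomputable abbrev freeCover : FirmMod R := ∐ fun _ : M.obj.carrier => self R

/-- The inclusion of the summand indexed by `m`. -/
noncomputable abbrev gen (m : M.obj.carrier) : self R ⟶ freeCover M :=
  Sigma.ι (fun _ : M.obj.carrier => self R) m

/-- The canonical map `⨁ R → M`, equal to `r ↦ m r` on the summand indexed by `m`. -/
noncomputable def orbits : freeCover M ⟶ M := Sigma.desc (orbit M)

theorem gen_orbits (m : M.obj.carrier) : gen M m ≫ orbits M = orbit M m := Sigma.ι_desc _ _

/-- The relations between the generators of `M`: additivity in `M`, and balancedness over `R`. -/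
noncomputable def relator :
    (M.obj.carrier × M.obj.carrier) ⊕ (R × M.obj.carrier) → (self R ⟶ freeCover M)
  | .inl (m, m') => gen M (m + m') - (gen M m + gen M m')
  | .inr (r, m) => gen M (op r • m) - lmul R r ≫ gen M m

/-- The sum of all relations between the generators of `M`. -/
noncomputable def relations :
    ∐ (fun _ : (M.obj.carrier × M.obj.carrier) ⊕ (R × M.obj.carrier) => self R) ⟶ freeCover M :=
  Sigma.desc (relator M)

variable {M} in
theorem map_relations_comp_eq_zero_iff (F : FirmMod R ⥤ D) [F.Additive]
    [∀ J : Type u, PreservesColimitsOfShape (Discrete J) F] {X : D}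
    (h : F.obj (freeCover M) ⟶ X) :
    F.map (relations M) ≫ h = 0 ↔
      ∃ k : M.obj ⟶ homRMod (selfAction F) X, ∀ m, k.toAddHom m = F.map (gen M m) ≫ h := by
  have relators : F.map (relations M) ≫ h = 0 ↔ ∀ i, F.map (relator M i) ≫ h = 0 := by
    have hsum := isColimitOfHasCoproductOfPreservesColimit F fun
      _ : (M.obj.carrier × M.obj.carrier) ⊕ (R × M.obj.carrier) => self R
    have map_ι_relations (i) :
        F.map (Sigma.ι _ i) ≫ F.map (relations M) ≫ h = F.map (relator M i) ≫ h := by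
      rw [← F.map_comp_assoc, relations, Sigma.ι_desc]
    refine ⟨fun h0 i => by rw [← map_ι_relations, h0, comp_zero],
      fun h0 => Cofan.IsColimit.hom_ext hsum _ _ fun i => ?_⟩
    exact (map_ι_relations i).trans ((h0 i).trans comp_zero.symm)
  have add_relator (m m') : F.map (relator M (.inl (m, m'))) ≫ h = 0 ↔
      F.map (gen M (m + m')) ≫ h = F.map (gen M m) ≫ h + F.map (gen M m') ≫ h := by
    rw [relator, F.map_sub, F.map_add, Preadditive.sub_comp, Preadditive.add_comp, sub_eq_zero]
  have smul_relator (r m) : F.map (relator M (.inr (r, m))) ≫ h = 0 ↔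
      F.map (gen M (op r • m)) ≫ h = F.map (lmul R r) ≫ F.map (gen M m) ≫ h := by
    rw [relator, F.map_sub, F.map_comp, Preadditive.sub_comp, Category.assoc, sub_eq_zero]
  rw [relators, Sum.forall, Prod.forall, Prod.forall]
  simp only [add_relator, smul_relator]
  refine ⟨fun ⟨hadd, hsmul⟩ => ⟨RMod.Hom.mk (AddMonoidHom.mk' (fun m => F.map (gen M m) ≫ h) hadd)
    hsmul, fun _ => rfl⟩, fun ⟨k, hk⟩ => ⟨fun m m' => ?_, fun r m => ?_⟩⟩
  · rw [← hk, ← hk, ← hk]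
    exact map_add k.toAddHom m m'
  · rw [← hk, ← hk]
    exact k.map_op_smul r m

theorem relations_orbits : relations M ≫ orbits M = 0 :=
  (map_relations_comp_eq_zero_iff (𝟭 _) (orbits M)).2
    ⟨precompOrbit (𝟭 _) M M (𝟙 M), fun m => (Category.comp_id _).trans (gen_orbits M m).symm⟩

instance : Epi (orbits M) := ⟨fun f g hfg => (precompOrbit_id_bijective M _).1 <|
  RMod.Hom.ext <| AddMonoidHom.ext fun m => by
    change orbit M m ≫ f = orbit M m ≫ g
    rw [← gen_orbits, Category.assoc, Category.assoc, hfg]⟩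

/-- `M` is the cokernel of the relations between its generators. -/
noncomputable def isColimitOrbits :
    IsColimit (CokernelCofork.ofπ (orbits M) (relations_orbits M)) :=
  CokernelCofork.IsColimit.ofπ' _ _ fun {N} h hh => by
    choose k hk using (map_relations_comp_eq_zero_iff (𝟭 _) h).1 hh
    choose f hf using (precompOrbit_id_bijective M N).2 k
    refine ⟨f, Sigma.hom_ext _ _ fun m => ?_⟩
    rw [← Category.assoc, gen_orbits]
    exact (congrArg (fun l : RMod.Hom _ _ => l.toAddHom m) hf).trans (hk m)

variable (F : FirmMod R ⥤ D) [F.Additive] [PreservesFiniteColimits F]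
  [∀ J : Type u, PreservesColimitsOfShape (Discrete J) F]

theorem precompOrbit_bijective (X : D) : Function.Bijective (precompOrbit F M X) := by
  have hcover := isColimitOfHasCoproductOfPreservesColimit F fun _ : M.obj.carrier => self R
  have hcok := CokernelCofork.mapIsColimit _ (isColimitOrbits M) F
  have map_orbit_comp (f : F.obj M ⟶ X) (m) :
      F.map (orbit M m) ≫ f = F.map (gen M m) ≫ F.map (orbits M) ≫ f := by
    rw [← gen_orbits, F.map_comp, Category.assoc]
  refine ⟨fun f g hfg => ?_, fun k => ?_⟩
  · refine Cofork.IsColimit.hom_ext hcok (Cofan.IsColimit.hom_ext hcover _ _ fun m => ?_)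
    refine (map_orbit_comp f m).symm.trans (Eq.trans ?_ (map_orbit_comp g m))
    exact congrArg (fun h : RMod.Hom _ _ => h.toAddHom m) hfg
  · let h : F.obj (freeCover M) ⟶ X := Cofan.IsColimit.desc hcover k.toAddHom
    have gen_h (m) : F.map (gen M m) ≫ h = k.toAddHom m := Cofan.IsColimit.fac hcover k.toAddHom m
    obtain ⟨f, hf⟩ : ∃ f : F.obj M ⟶ X, F.map (orbits M) ≫ f = h :=
      ⟨_, (CokernelCofork.IsColimit.desc' hcok h
        ((map_relations_comp_eq_zero_iff F h).2 ⟨k, fun m => (gen_h m).symm⟩)).2⟩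
    exact ⟨f, RMod.Hom.ext (AddMonoidHom.ext fun m =>
      (map_orbit_comp f m).trans ((congrArg _ hf).trans (gen_h m)))⟩

end FirmMod

namespace Bicomod

variable {R : Type u} [NonUnitalRing R] {A : Type u} [Ring A] {C : Type u} [AddCommGroup C]
  [Module A C] [Module Aᵐᵒᵖ C] [SMulCommClass A Aᵐᵒᵖ C] [Coring A C] (B : Bicomod R A C)

/-- The colinear map `u ↦ m ⊗ u`. -/
def pure (M : RMod R) (m : M.carrier) : B.toComod ⟶ B.tensorObj M :=
  ⟨B.pureTensor M m, fun _ => rfl⟩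

variable {B}

theorem tensorObj_hom_ext {M : RMod R} {N : Comod A C} {f g : B.tensorObj M ⟶ N}
    (h : ∀ m, B.pure M m ≫ f = B.pure M m ≫ g) : f = g :=
  Subtype.ext (LinearMap.toAddMonoidHom_injective (Tens.hom_ext
    (f := f.1.toAddMonoidHom) (g := g.1.toAddMonoidHom) fun m u =>
      congrArg (fun k : B.toComod ⟶ N => k.1 u) (h m)))

/-- The colinear map `M ⊗_R Σ → N`, `m ⊗ u ↦ g(m)(u)`. -/
def tensorLift {M : RMod R} {N : Comod A C} (g : M ⟶ B.homComod.obj N) : B.tensorObj M ⟶ N :=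
  let eval : M.carrier →+ B.carrier →+ N.carrier :=
    AddMonoidHom.mk' (fun m => (show B.toComod ⟶ N from g.toAddHom m).1.toAddMonoidHom)
      fun m m' => congrArg (fun k : B.toComod ⟶ N => k.1.toAddMonoidHom) (map_add g.toAddHom m m')
  let l : Tens R M.carrier B.carrier →+ N.carrier := Tens.lift eval fun r m u =>
    congrArg (fun k : B.toComod ⟶ N => k.1 u) (g.map_op_smul r m)
  let linear : Tens R M.carrier B.carrier →ₗ[Aᵐᵒᵖ] N.carrier :=
    { l with
      map_smul' := fun a => Tens.hom_congr (f := l.comp (smulHom _ a))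
        (g := (smulHom _ a).comp l)
        fun m u => (show B.toComod ⟶ N from g.toAddHom m).1.map_smul a u }
  ⟨linear, Tens.hom_congr (f := N.coact.toAddMonoidHom.comp l)
    (g := (tensorCoring C linear).comp (B.tensorCoact M)) fun m u =>
      ((show B.toComod ⟶ N from g.toAddHom m).2 u).trans
        (tensorCoring_comp linear (B.pureTensor M m) (B.coact u))⟩

variable (B)

/-- The tensor-hom adjunction. -/
def tensorAdj : B.tensor ⊣ B.homComod :=
  Adjunction.mkOfHomEquiv
    { homEquiv := fun M N =>
        { toFun := fun f => RMod.Hom.mk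
            (AddMonoidHom.mk' (fun m => (B.pure M m ≫ f : B.toComod ⟶ N)) fun m m' =>
              Subtype.ext (LinearMap.ext fun u =>
                (congrArg f.1 (Tens.add_tmul m m' u)).trans (map_add f.1 _ _)))
            fun r m => Subtype.ext (LinearMap.ext fun u => congrArg f.1 (Tens.smul_tmul r m u))
          invFun := tensorLift
          left_inv := fun _ => tensorObj_hom_ext fun _ => rfl
          right_inv := fun _ => rfl }
      homEquiv_naturality_left_symm := fun _ _ => tensorObj_hom_ext fun _ => rfl
      homEquiv_naturality_right := fun _ _ => rfl }

/-- The left action of `R` on `Σ`, as a ring morphism into the colinear endomorphisms. -/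
def lmulHom : R →ₙ+* End B.toComod where
  toFun := B.lmul
  map_mul' r s := Subtype.ext (LinearMap.ext (NUModule.mul_smul r s))
  map_zero' := Subtype.ext (LinearMap.ext fun u => by
    have h := NUModule.add_smul 0 (0 : R) u
    rwa [add_zero, left_eq_add] at h)
  map_add' r s := Subtype.ext (LinearMap.ext (NUModule.add_smul r s))

variable {B}

/-- The colinear map `u ↦ f(u₀) ⊗ u₁` corresponding to the linear map `f`. -/
def cofreeLift {M : ModuleCat.{u} Aᵐᵒᵖ} (f : B.carrier →ₗ[Aᵐᵒᵖ] M) :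
    B.toComod ⟶ (cofree A C).obj M :=
  let l : B.carrier →ₗ[Aᵐᵒᵖ] Tens A M C := tensorCoringLin C f ∘ₗ B.coact
  ⟨l, fun u =>
    (coassoc_tensorCoring f (B.coact u)).trans
      ((congrArg (tensorCoring C (tensorCoringLin C f)) (B.coassoc u)).trans
        (tensorCoring_comp (tensorCoringLin C f) B.coact (B.coact u)).symm)⟩

theorem cofreeLift_add {M : ModuleCat.{u} Aᵐᵒᵖ} (f g : B.carrier →ₗ[Aᵐᵒᵖ] M) :
    cofreeLift (f + g) = cofreeLift f + cofreeLift g :=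
  Subtype.ext (LinearMap.ext fun u =>
    Tens.hom_congr (f := tensorCoring C (f + g)) (g := tensorCoring C f + tensorCoring C g)
      (fun m c => Tens.add_tmul (f m) (g m) c) (B.coact u))

theorem cofreeLift_comp_lmul {M : ModuleCat.{u} Aᵐᵒᵖ} (f : B.carrier →ₗ[Aᵐᵒᵖ] M) (r : R) :
    cofreeLift (f ∘ₗ (B.lmul r).1) = B.lmul r ≫ cofreeLift f :=
  Subtype.ext (LinearMap.ext fun u =>
    (tensorCoring_comp f (B.lmul r).1 (B.coact u)).trans
      (congrArg (tensorCoring C f) (B.coact_smul r u).symm))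

variable (B)

/-- The natural map `Hom_A(Σ, -) → Hom^C(Σ, - ⊗_A C)` given by `cofreeLift`. -/
def cofreeLiftHom : B.homMod ⟶ cofree A C ⋙ B.homComod where
  app _ := RMod.Hom.mk (AddMonoidHom.mk' cofreeLift cofreeLift_add)
    fun r f => cofreeLift_comp_lmul f r
  naturality M _ g := RMod.Hom.ext (AddMonoidHom.ext fun f => Subtype.ext (LinearMap.ext fun u =>
    tensorCoring_comp g.hom (show B.carrier →ₗ[Aᵐᵒᵖ] M from f) (B.coact u)))

/-- The canonical map `Hom_A(Σ, -) ⊗_R Σ → - ⊗_A C`, the transpose of `cofreeLiftHom`. -/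
def can : B.homMod ⋙ B.tensor ⟶ cofree A C :=
  Functor.whiskerRight B.cofreeLiftHom B.tensor ≫
    Functor.whiskerLeft (cofree A C) B.tensorAdj.counit

theorem can_app_tmul (M : ModuleCat.{u} Aᵐᵒᵖ) (f : B.carrier →ₗ[Aᵐᵒᵖ] M) (u : B.carrier) :
    (B.can.app M).1 (Tens.tmul R (M := (B.homMod.obj M).carrier) f u) =
      tensorCoring C f (B.coact u) :=
  rfl

/-- On firm modules, `- ⊗_R Σ` is left adjoint to `Hom^C(Σ, -) ⊗_R R`. -/
noncomputable def tensorFirmAdj [IsFirmRing R] : B.tensorFirm ⊣ B.homFirm :=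
  (firmificationAdj R).comp B.tensorAdj

end Bicomod

variable {R : Type u} [NonUnitalRing R] [IsFirmRing R] {A : Type u} [Ring A] {C : Type u}
  [AddCommGroup C] [Module A C] [Module Aᵐᵒᵖ C] [SMulCommClass A Aᵐᵒᵖ C] [Coring A C]

theorem Comod.bijective_of_isIso {M N : Comod A C} (f : M ⟶ N) [IsIso f] : Function.Bijective f.1 :=
  Function.bijective_iff_has_inverse.2 ⟨(inv f).1,
    fun x => congrArg (fun g : M ⟶ M => g.1 x) (IsIso.hom_inv_id f),
    fun x => congrArg (fun g : N ⟶ N => g.1 x) (IsIso.inv_hom_id f)⟩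

section SelfBicomod

variable (F : FirmMod R ⥤ Comod A C) [F.Additive]

/-- The comodule `F(R)` with the left action of `R` through `F`. -/
abbrev selfBicomod : Bicomod R A C := Bicomod.ofHom (F.obj (FirmMod.self R)) (FirmMod.selfAction F)

/-- The natural map `M ⊗_R F(R) → F(M)`, `m ⊗ u ↦ F(r ↦ m r)(u)`. -/
def tensorSelfHom : (selfBicomod F).tensorFirm ⟶ F where
  app M := ((selfBicomod F).tensorAdj.homEquiv M.obj (F.obj M)).symm
    (FirmMod.precompOrbit F M (F.obj M) (𝟙 _))
  naturality M N f := Bicomod.tensorObj_hom_ext fun m => by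
    change F.map (FirmMod.orbit N (f.hom.toAddHom m)) ≫ 𝟙 _ =
      (F.map (FirmMod.orbit M m) ≫ 𝟙 _) ≫ F.map f
    rw [Category.comp_id, Category.comp_id, ← F.map_comp, FirmMod.orbit_comp]

theorem homEquiv_tensorSelfHom_comp (M : FirmMod R) {X : Comod A C} (f : F.obj M ⟶ X) :
    (selfBicomod F).tensorAdj.homEquiv M.obj X ((tensorSelfHom F).app M ≫ f) =
      FirmMod.precompOrbit F M X f := by
  refine RMod.Hom.ext (AddMonoidHom.ext fun m => ?_)
  change (F.map (FirmMod.orbit M m) ≫ 𝟙 _) ≫ f = F.map (FirmMod.orbit M m) ≫ f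
  rw [Category.comp_id]

variable [PreservesFiniteColimits F] [∀ J : Type u, PreservesColimitsOfShape (Discrete J) F]

instance : IsIso (tensorSelfHom F) := by
  have (M : FirmMod R) : IsIso ((tensorSelfHom F).app M) :=
    isIso_of_coyoneda_map_bijective _ fun X => by
      have h := FirmMod.precompOrbit_bijective M F X
      rw [← funext (homEquiv_tensorSelfHom_comp F M)] at h
      exact (Function.Bijective.of_comp_iff' (Equiv.bijective _) _).1 h
  exact NatIso.isIso_of_isIso_app _

theorem isFirm_selfBicomod : (selfBicomod F).IsFirm := by
  have app_self : ((tensorSelfHom F).app (FirmMod.self R)).1.toAddMonoidHom =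
      mulLeft R (selfBicomod F).carrier := Tens.hom_ext fun _ _ => rfl
  have h := Comod.bijective_of_isIso ((tensorSelfHom F).app (FirmMod.self R))
  exact (congrArg (fun f : Tens R R (selfBicomod F).carrier →+ (selfBicomod F).carrier =>
    Function.Bijective f) app_self).mp h

end SelfBicomod

theorem exists_additive_selfBicomod (F : FirmMod R ⥤ Comod A C) [PreservesFiniteColimits F]
    [∀ J : Type u, PreservesColimitsOfShape (Discrete J) F] :
    ∃ _ : F.Additive, (selfBicomod F).IsFirm ∧ Nonempty (F ≅ (selfBicomod F).tensorFirm) :=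
  have := additive_of_preservesFiniteCoproducts F
  ⟨this, isFirm_selfBicomod F, ⟨(asIso (tensorSelfHom F)).symm⟩⟩

end FirmCoring

theorem theorem3p2_general {R : Type u} [NonUnitalRing R] [IsFirmRing R]
    {A : Type u} [Ring A] {C : Type u} [AddCommGroup C] [Module A C] [Module Aᵐᵒᵖ C]
    [SMulCommClass A Aᵐᵒᵖ C] [Coring A C] (F : FirmMod R ⥤ Comod A C) :
    List.TFAE
      [ F.IsLeftAdjoint,
        PreservesFiniteColimits F ∧ ∀ J : Type u, PreservesColimitsOfShape (Discrete J) F,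
        ∃ B : Bicomod R A C, B.IsFirm ∧ Nonempty (F ≅ B.tensorFirm) ] ∧
    (F.IsLeftAdjoint →
      ∃ j : R →ₙ+* End (F.obj (FirmMod.self R)),
        (∀ r : R, j r = F.map (FirmMod.lmul R r)) ∧
        (Bicomod.ofHom (F.obj (FirmMod.self R)) j).IsFirm ∧
        Nonempty (F ≅ (Bicomod.ofHom (F.obj (FirmMod.self R)) j).tensorFirm)) ∧
    ∀ B : Bicomod R A C,
      (Nonempty (F ≅ B.tensorFirm) →
        Nonempty (F ⊣ B.homFirm) ∧
          ∀ G : Comod A C ⥤ FirmMod R, Nonempty (F ⊣ G) → Nonempty (G ≅ B.homFirm)) ∧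
      (∃ j : R →ₙ+* End B.toComod, ∀ (r : R) (u : B.carrier), (j r).1 u = r • u) ∧
      (∃ can : B.homMod ⋙ B.tensor ⟶ cofree A C,
        ∀ (M : ModuleCat.{u} Aᵐᵒᵖ) (f : B.carrier →ₗ[Aᵐᵒᵖ] M) (u : B.carrier),
          (can.app M).1 (Tens.tmul R (M := (B.homMod.obj M).carrier) f u) =
            tensorCoring C f (B.coact u)) := by
  have preserves (h : F.IsLeftAdjoint) : PreservesFiniteColimits F ∧
      ∀ J : Type u, PreservesColimitsOfShape (Discrete J) F := by
    have := (Adjunction.ofIsLeftAdjoint F).leftAdjoint_preservesColimits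
    exact ⟨inferInstance, fun _ => inferInstance⟩
  have adj (B : Bicomod R A C) (e : F ≅ B.tensorFirm) : F ⊣ B.homFirm :=
    B.tensorFirmAdj.ofNatIsoLeft e.symm
  refine ⟨?_, fun hF => ?_, fun B => ⟨fun ⟨e⟩ => ?_, ?_, ?_⟩⟩
  · tfae_have 1 → 2 := preserves
    tfae_have 2 → 3 := fun ⟨_, _⟩ =>
      let ⟨_, h⟩ := exists_additive_selfBicomod F
      ⟨selfBicomod F, h⟩
    tfae_have 3 → 1 := fun ⟨B, _, ⟨e⟩⟩ => (adj B e).isLeftAdjoint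
    tfae_finish
  · obtain ⟨_, _⟩ := preserves hF
    obtain ⟨_, h⟩ := exists_additive_selfBicomod F
    exact ⟨FirmMod.selfAction F, fun _ => rfl, h⟩
  · exact ⟨⟨adj B e⟩, fun G ⟨adj'⟩ => ⟨adj'.rightAdjointUniq (adj B e)⟩⟩
  · exact ⟨B.lmulHom, fun _ _ => rfl⟩
  · exact ⟨B.can, B.can_app_tmul⟩

theorem theorem3p2 {R : Type u} [NonUnitalRing R] [IsFirmRing R]
    {A : Type u} [Ring A] {C : Type u} [AddCommGroup C] [Module A C] [Module Aᵐᵒᵖ C]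
    [SMulCommClass A Aᵐᵒᵖ C] [Coring A C] (F : FirmMod R ⥤ Comod A C) :
    -- right adjoint; right exact and direct sums; tensor functor
    List.TFAE
      [ F.IsLeftAdjoint,
        PreservesFiniteColimits F ∧ ∀ J : Type u, PreservesColimitsOfShape (Discrete J) F,
        ∃ B : Bicomod R A C, B.IsFirm ∧ Nonempty (F ≅ B.tensorFirm) ] ∧
    (F.IsLeftAdjoint →
      -- `F(R)`, with `R` acting through `F`, is a bicomodule that represents `F`
      (∃ j : R →ₙ+* End (F.obj (FirmMod.self R)),
        (∀ r : R, j r = F.map (FirmMod.lmul R r)) ∧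
        (Bicomod.ofHom (F.obj (FirmMod.self R)) j).IsFirm ∧
        Nonempty (F ≅ (Bicomod.ofHom (F.obj (FirmMod.self R)) j).tensorFirm)) ∧
      -- right adjoint, ring morphism and canonical map, for every bicomodule representing `F`
      ∀ B : Bicomod R A C, B.IsFirm → Nonempty (F ≅ B.tensorFirm) →
        (Nonempty (F ⊣ B.homFirm) ∧
          ∀ G : Comod A C ⥤ FirmMod R, Nonempty (F ⊣ G) → Nonempty (G ≅ B.homFirm)) ∧
        (∃ j : R →ₙ+* End B.toComod, ∀ (r : R) (u : B.carrier), (j r).1 u = r • u) ∧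
        (∃ can : B.homMod ⋙ B.tensor ⟶ cofree A C,
          ∀ (M : ModuleCat.{u} Aᵐᵒᵖ) (f : B.carrier →ₗ[Aᵐᵒᵖ] M) (u : B.carrier),
            (can.app M).1 (Tens.tmul R (M := (B.homMod.obj M).carrier) f u) =
              tensorCoring C f (B.coact u))) := by
  obtain ⟨tfae, self, rep⟩ := theorem3p2_general F
  exact ⟨tfae, fun hF => ⟨self hF, fun B _ hB => ⟨(rep B).1 hB, (rep B).2⟩⟩⟩
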